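/- Let $\mathcal H_A,\mathcal H_B,\mathcal H_C$ be finite-dimensional complex Hilbert spaces and let $\rho_{ABC}$ be a density operator on $\mathcal H_A\otimes\mathcal H_B\otimes\mathcal H_C$ (subscripts denote marginals, obtained by partial trace). Let $\log$ be the natural logarithm, with $\log M=\sum_{a>0}(\log a)P_a$ for a positive semidefinite operator $M=\sum_a aP_a$ in spectral decomposition. Put $H(F)_\rho=-\operatorname{Tr}\{\rho_F\log\rho_F\}$, $$I(A;B|C)_\rho=H(AC)_\rho+H(BC)_\rho-H(C)_\rho-H(ABC)_\rho ,$$ and, for density operators $\tau_{AC},\theta_{BC},\omega_C$, $$\Delta(\rho_{ABC},\tau_{AC},\theta_{BC},\omega_C)=\operatorname{Tr}\{\rho_{ABC}[\log\rho_{ABC}-\log\tau_{AC}-\log\theta_{BC}+\log\omega_C]\},$$ with identity operators on the missing tensor factors understood. Then $$\begin{aligned} I(A;B|C)_\rho&=\Delta(\rho_{ABC},\rho_{AC},\rho_{BC},\rho_C)=\inf_{\tau_{AC}}\Delta(\rho_{ABC},\tau_{AC},\rho_{BC},\rho_C)\\ &=\inf_{\theta_{BC}}\Delta(\rho_{ABC},\rho_{AC},\theta_{BC},\rho_C)=\sup_{\omega_C}\Delta(\rho_{ABC},\rho_{AC},\rho_{BC},\omega_C)\\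 &=\inf_{\tau_{AC}}\Delta(\rho_{ABC},\tau_{AC},\rho_{BC},\tau_C)=\inf_{\tau_{AC}}\sup_{\omega_C}\Delta(\rho_{ABC},\tau_{AC},\rho_{BC},\omega_C)\\ &=\inf_{\theta_{BC}}\Delta(\rho_{ABC},\rho_{AC},\theta_{BC},\theta_C)=\inf_{\theta_{BC}}\sup_{\omega_C}\Delta(\rho_{ABC},\rho_{AC},\theta_{BC},\omega_C)\\ &=\inf_{\sigma_{ABC}}\Delta(\rho_{ABC},\sigma_{AC},\sigma_{BC},\rho_C)=\inf_{\tau_{AC},\theta_{BC}}\Delta(\rho_{ABC},\tau_{AC},\theta_{BC},\rho_C)\\ &=\inf_{\sigma_{ABC}}\Delta(\rho_{ABC},\sigma_{AC},\sigma_{BC},\sigma_C)=\inf_{\tau_{AC},\theta_{BC}}\Delta(\rho_{ABC},\tau_{AC},\theta_{BC},\tau_C)\\ &=\inf_{\tau_{AC},\theta_{BC}}\Delta(\rho_{ABC},\tau_{AC},\theta_{BC},\theta_C)=\inf_{\sigma_{ABC}}\sup_{\omega_C}\Delta(\rho_{ABC},\sigma_{AC},\sigma_{BC},\omega_C)\\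 &=\inf_{\tau_{AC},\theta_{BC}}\sup_{\omega_C}\Delta(\rho_{ABC},\tau_{AC},\theta_{BC},\omega_C), \end{aligned}$$ where the optimizations are over density operators $\tau_{AC},\theta_{BC},\omega_C,\sigma_{ABC}$ whose supports (after tensoring with the identity on the missing factors) contain $\operatorname{supp}(\rho_{ABC})$. In each expression that has both infima and a supremum, these can be interchanged (in any order) without changing the value. All the infima and suprema are attained, at the corresponding marginals of $\rho_{ABC}$ (at $\rho_{ABC}$ itself for $\sigma_{ABC}$), so they are minima and maxima. -/

import Mathlib

open scoped Kronecker ComplexOrder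

noncomputable section

namespace QInfo

/-- A density operator (state) on the Hilbert space `ℂⁿ`. -/
def IsState {n : Type*} [Fintype n] (M : Matrix n n ℂ) : Prop :=
  M.PosSemidef ∧ M.trace = 1

/-- The support of a Hermitian operator: the orthogonal complement of its kernel. -/
def supp {n : Type*} [Fintype n] [DecidableEq n] (M : Matrix n n ℂ) :
    Submodule ℂ (EuclideanSpace ℂ n) :=
  (LinearMap.ker (Matrix.toEuclideanLin M))ᗮ

/-- The logarithm of a Hermitian operator by functional calculus. Since `Real.log 0 = 0`, for a
positive semidefinite operator it is the sum of `log a • P_a` over the positive eigenvalues `a`,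
with `P_a` the spectral projections. -/
def logOp {n : Type*} [Fintype n] [DecidableEq n] (M : Matrix n n ℂ) : Matrix n n ℂ :=
  cfc (R := ℝ) Real.log M

/-- The von Neumann entropy `H(ρ) = -Tr{ρ log ρ}` (the trace is real for Hermitian `ρ`). -/
def entropy {n : Type*} [Fintype n] [DecidableEq n] (M : Matrix n n ℂ) : ℝ :=
  -(M * logOp M).trace.re

section systems

variable {A B C X Y : Type*}

/-- Partial trace over the first tensor factor. -/
def traceFst [Fintype X] (M : Matrix (X × Y) (X × Y) ℂ) : Matrix Y Y ℂ :=
  Matrix.of fun i j => ∑ x, M (x, i) (x, j)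

/-- The marginal on `AC` of an operator on `ABC`: partial trace over `B`. -/
def margAC [Fintype B] (M : Matrix (A × B × C) (A × B × C) ℂ) : Matrix (A × C) (A × C) ℂ :=
  Matrix.of fun i j => ∑ b, M (i.1, b, i.2) (j.1, b, j.2)

/-- The marginal on `BC` of an operator on `ABC`: partial trace over `A`. -/
def margBC [Fintype A] (M : Matrix (A × B × C) (A × B × C) ℂ) : Matrix (B × C) (B × C) ℂ :=
  traceFst M

/-- The marginal on `C` of an operator on `ABC`: partial trace over `A` and `B`. -/
def margC [Fintype A] [Fintype B] (M : Matrix (A × B × C) (A × B × C) ℂ) : Matrix C C ℂ :=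
  traceFst (traceFst M)

/-- The operator on `ABC` that acts as `M` on `AC` and as the identity on `B`. -/
def extAC [DecidableEq B] (M : Matrix (A × C) (A × C) ℂ) :
    Matrix (A × B × C) (A × B × C) ℂ :=
  (M ⊗ₖ (1 : Matrix B B ℂ)).submatrix
    (fun i => ((i.1, i.2.2), i.2.1)) (fun i => ((i.1, i.2.2), i.2.1))

/-- The operator on `ABC` that acts as `M` on `BC` and as the identity on `A`. -/
def extBC [DecidableEq A] (M : Matrix (B × C) (B × C) ℂ) :
    Matrix (A × B × C) (A × B × C) ℂ :=
  (1 : Matrix A A ℂ) ⊗ₖ M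

/-- The operator on `ABC` that acts as `M` on `C` and as the identity on `AB`. -/
def extC [DecidableEq A] [DecidableEq B] (M : Matrix C C ℂ) :
    Matrix (A × B × C) (A × B × C) ℂ :=
  (1 : Matrix A A ℂ) ⊗ₖ ((1 : Matrix B B ℂ) ⊗ₖ M)

variable [Fintype A] [Fintype B] [Fintype C] [DecidableEq A] [DecidableEq B] [DecidableEq C]

/-- The conditional quantum mutual information
`I(A;B|C)_ρ = H(AC)_ρ + H(BC)_ρ - H(C)_ρ - H(ABC)_ρ`. -/
def condMutualInfo (ρ : Matrix (A × B × C) (A × B × C) ℂ) : ℝ :=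
  entropy (margAC ρ) + entropy (margBC ρ) - entropy (margC ρ) - entropy ρ

/-- `Δ(ρ_ABC, τ_AC, θ_BC, ω_C) = Tr{ρ_ABC [log ρ_ABC - log τ_AC - log θ_BC + log ω_C]}`, identity
operators on the missing tensor factors being implicit (the trace is real for Hermitian
arguments). -/
def Delta (ρ : Matrix (A × B × C) (A × B × C) ℂ) (τ : Matrix (A × C) (A × C) ℂ)
    (θ : Matrix (B × C) (B × C) ℂ) (ω : Matrix C C ℂ) : ℝ :=
  (ρ * (logOp ρ - extAC (logOp τ) - extBC (logOp θ) + extC (logOp ω))).trace.re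

/-- The states `τ_AC` with `supp ρ_ABC ⊆ supp τ_AC`. -/
def statesAC (ρ : Matrix (A × B × C) (A × B × C) ℂ) : Set (Matrix (A × C) (A × C) ℂ) :=
  {τ | IsState τ ∧ supp ρ ≤ supp (extAC (B := B) τ)}

/-- The states `θ_BC` with `supp ρ_ABC ⊆ supp θ_BC`. -/
def statesBC (ρ : Matrix (A × B × C) (A × B × C) ℂ) : Set (Matrix (B × C) (B × C) ℂ) :=
  {θ | IsState θ ∧ supp ρ ≤ supp (extBC (A := A) θ)}

/-- The states `ω_C` with `supp ρ_ABC ⊆ supp ω_C`. -/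
def statesC (ρ : Matrix (A × B × C) (A × B × C) ℂ) : Set (Matrix C C ℂ) :=
  {ω | IsState ω ∧ supp ρ ≤ supp (extC (A := A) (B := B) ω)}

/-- The states `σ_ABC` with `supp ρ_ABC ⊆ supp σ_ABC`. -/
def statesABC (ρ : Matrix (A × B × C) (A × B × C) ℂ) :
    Set (Matrix (A × B × C) (A × B × C) ℂ) :=
  {σ | IsState σ ∧ supp ρ ≤ supp σ}

end systems

/-- The infimum of `f` over `S` is `v`, and it is attained at the point `x₀` of `S`. -/
def InfAttained {X : Type*} (S : Set X) (f : X → EReal) (x₀ : X) (v : EReal) : Prop :=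
  (⨅ x ∈ S, f x) = v ∧ x₀ ∈ S ∧ f x₀ = v

/-- The supremum of `f` over `S` is `v`, and it is attained at the point `x₀` of `S`. -/
def SupAttained {X : Type*} (S : Set X) (f : X → EReal) (x₀ : X) (v : EReal) : Prop :=
  (⨆ x ∈ S, f x) = v ∧ x₀ ∈ S ∧ f x₀ = v

/-- `inf_{x ∈ S} sup_{y ∈ T} f x y = sup_{y ∈ T} inf_{x ∈ S} f x y = v`, where all the infima
and suprema, the inner ones included, are attained, at `x₀` and at `y₀` respectively. -/
def InfSupAttained {X Y : Type*} (S : Set X) (T : Set Y) (f : X → Y → EReal)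
    (x₀ : X) (y₀ : Y) (v : EReal) : Prop :=
  InfAttained S (fun x => ⨆ y ∈ T, f x y) x₀ v ∧
  SupAttained T (fun y => ⨅ x ∈ S, f x y) y₀ v ∧
  (∀ x ∈ S, SupAttained T (fun y => f x y) y₀ (⨆ y ∈ T, f x y)) ∧
  (∀ y ∈ T, InfAttained S (fun x => f x y) x₀ (⨅ x ∈ S, f x y))

end QInfo

end

/-! Write D for relative entropy. Since tracing out a factor is adjoint to tensoring with its
identity, the traces in `Delta` regroup (`Delta_eq`) as Δ(ρ, τ, θ, ω) = I(A;B|C) + D(ρ_AC‖τ) +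
D(ρ_BC‖θ) - D(ρ_C‖ω). With independent arguments, each D is nonnegative (Klein) and vanishes at the
marginal, so minimizers and maximizers do not depend on the other variables and inf and sup
interchange. When ω is the C-marginal of τ or θ, the negative term is dominated by D(ρ_AC‖τ) or
D(ρ_BC‖θ), by monotonicity of D under partial trace.

Klein's inequality and monotonicity both come from `relEntropy_le_of_modularQuad`. For the relative
modular operator, with eigenvalues q_j/p_i, the expectation F(t) of log(· + t) has F(0) = -D(ρ‖σ),
and F(t) - tr ρ · log t tends to 0 at infinity. Its derivative, a resolvent expectation, is the
maximum over X of the quadratic form `modularQuad`. A partial trace amounts to restricting X to the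
operators 1 ⊗ N, which lowers the maximum. Hence the difference of the two functions F is
nondecreasing with limit 0, so it is nonpositive at 0. -/

namespace QInfo

open Matrix Filter Topology

/-! ### Relative entropy via resolvents of the relative modular operator -/

section RelativeEntropy

variable {n : Type*} [Fintype n] [DecidableEq n]

/-- The quantum relative entropy `D(ρ‖σ) = Tr{ρ (log ρ - log σ)}`. -/
noncomputable def relEntropy (ρ σ : Matrix n n ℂ) : ℝ :=
  (ρ * logOp ρ).trace.re - (ρ * logOp σ).trace.re

/-- The concave quadratic functional whose maximum over `X` is the resolvent of the relative
modular operator of `σ` and `ρ` at `-t`, in the state given by the square root of `ρ`. -/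
noncomputable def modularQuad (ρ σ : Matrix n n ℂ) (t : ℝ) (X : Matrix n n ℂ) : ℝ :=
  2 * (ρ * X).trace.re - (σ * (X * Xᴴ)).trace.re - t * (ρ * (Xᴴ * X)).trace.re

lemma exists_diagonalization {M : Matrix n n ℂ} (hM : M.PosSemidef) :
    ∃ (U : Matrix n n ℂ) (p : n → ℝ), Uᴴ * U = 1 ∧ U * Uᴴ = 1 ∧ (∀ i, 0 ≤ p i) ∧
      M = U * diagonal (fun i => (p i : ℂ)) * Uᴴ ∧
      logOp M = U * diagonal (fun i => (Real.log (p i) : ℂ)) * Uᴴ := by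
  refine ⟨hM.1.eigenvectorUnitary, hM.1.eigenvalues, ?_, ?_, hM.eigenvalues_nonneg, ?_, ?_⟩
  · exact Unitary.coe_star_mul_self hM.1.eigenvectorUnitary
  · exact Unitary.coe_mul_star_self hM.1.eigenvectorUnitary
  · exact hM.1.spectral_theorem
  · exact hM.1.cfc_eq Real.log

lemma trace_diagonal_conj {m : Type*} [Fintype m] [DecidableEq m] (p : n → ℝ) (l : m → ℝ)
    (Y : Matrix m n ℂ) :
    (diagonal (fun i => (p i : ℂ)) * (Yᴴ * (diagonal (fun j => (l j : ℂ)) * Y))).trace.re =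
      ∑ i, ∑ j, p i * l j * Complex.normSq (Y j i) := by
  simp only [trace, diag_apply, diagonal_mul, Matrix.mul_apply (M := Yᴴ), conjTranspose_apply,
    Complex.re_sum, Finset.mul_sum]
  refine Finset.sum_congr rfl fun i _ => Finset.sum_congr rfl fun j _ => ?_
  simp [Complex.normSq_apply]
  ring

variable {U V : Matrix n n ℂ} {p q : n → ℝ}

lemma trace_mul_conj (hU : Uᴴ * U = 1) (Y : Matrix n n ℂ) :
    (U * diagonal (fun i => (p i : ℂ)) * Uᴴ * (V * Y * Uᴴ)).trace.re =
      ∑ i, ∑ j, p i * (star ((Vᴴ * U) j i) * Y j i).re := by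
  have : (U * diagonal (fun i => (p i : ℂ)) * Uᴴ * (V * Y * Uᴴ)).trace =
      (diagonal (fun i => (p i : ℂ)) * ((Vᴴ * U)ᴴ * Y)).trace := by
    rw [conjTranspose_mul, conjTranspose_conjTranspose]
    calc _ = (U * (diagonal (fun i => (p i : ℂ)) * (Uᴴ * (V * (Y * Uᴴ))))).trace := by
          simp only [Matrix.mul_assoc]
      _ = _ := by
        rw [trace_mul_comm]
        simp only [Matrix.mul_assoc, hU, Matrix.mul_one]
  rw [this]
  simp only [trace, diag_apply, diagonal_mul, Matrix.mul_apply (M := (Vᴴ * U)ᴴ),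
    conjTranspose_apply (Vᴴ * U), Complex.re_sum, Finset.mul_sum, Complex.re_ofReal_mul]

lemma trace_mul_diagonal_conj (l : n → ℝ) :
    (U * diagonal (fun i => (p i : ℂ)) * Uᴴ * (V * diagonal (fun i => (l i : ℂ)) * Vᴴ)).trace.re =
      ∑ i, ∑ j, p i * l j * Complex.normSq ((Vᴴ * U) j i) := by
  rw [← trace_diagonal_conj, conjTranspose_mul, conjTranspose_conjTranspose]
  congr 1
  calc _ = (U * (diagonal (fun i => (p i : ℂ)) * (Uᴴ * (V *
          (diagonal (fun i => (l i : ℂ)) * Vᴴ))))).trace := by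
          simp only [Matrix.mul_assoc]
      _ = _ := by
        rw [trace_mul_comm]
        simp only [Matrix.mul_assoc]

lemma sum_normSq_col_eq_one {W : Matrix n n ℂ} (hW : Wᴴ * W = 1) (i : n) :
    ∑ j, Complex.normSq (W j i) = 1 := by
  have h := congrFun (congrFun hW i) i
  rw [Matrix.mul_apply, one_apply_eq] at h
  have h' := congrArg Complex.re h
  rw [Complex.re_sum] at h'
  simpa [Complex.normSq_apply] using h'

lemma trace_diagonalized (hU : Uᴴ * U = 1) :
    (U * diagonal (fun i => (p i : ℂ)) * Uᴴ).trace.re = ∑ i, p i := by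
  rw [trace_mul_comm, ← Matrix.mul_assoc, hU, Matrix.one_mul]
  simp [trace, Complex.re_sum]

/-- In eigenbases of ρ and σ the quadratic form decouples: each matrix entry of Y enters its own
scalar quadratic, so maximization can be done entry by entry. -/
lemma modularQuad_diagonalized (hU : Uᴴ * U = 1) (hV : Vᴴ * V = 1) (t : ℝ) (Y : Matrix n n ℂ) :
    modularQuad (U * diagonal (fun i => (p i : ℂ)) * Uᴴ) (V * diagonal (fun i => (q i : ℂ)) * Vᴴ)
      t (V * Y * Uᴴ) =
    ∑ i, ∑ j, (2 * (p i * (star ((Vᴴ * U) j i) * Y j i).re) -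
      (q j + t * p i) * Complex.normSq (Y j i)) := by
  have h1 : (V * diagonal (fun i => (q i : ℂ)) * Vᴴ * (V * Y * Uᴴ * (V * Y * Uᴴ)ᴴ)).trace.re =
      ∑ i, ∑ j, q j * Complex.normSq (Y j i) := by
    have := trace_diagonal_conj (fun _ : n => (1 : ℝ)) q Y
    simp only [one_mul, Complex.ofReal_one, diagonal_one] at this
    rw [← this]
    congr 1
    calc _ = (V * (diagonal (fun i => (q i : ℂ)) * (Vᴴ * V * (Y * (Uᴴ * U * Yᴴ * Vᴴ))))).trace := by
          simp only [conjTranspose_mul, conjTranspose_conjTranspose, Matrix.mul_assoc]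
      _ = (diagonal (fun i => (q i : ℂ)) * Y * Yᴴ * (Vᴴ * V)).trace := by
          rw [trace_mul_comm]
          simp only [hU, hV, Matrix.one_mul, Matrix.mul_assoc]
      _ = _ := by
          rw [hV, Matrix.mul_one, trace_mul_comm]
  have h2 : (U * diagonal (fun i => (p i : ℂ)) * Uᴴ * ((V * Y * Uᴴ)ᴴ * (V * Y * Uᴴ))).trace.re =
      ∑ i, ∑ j, p i * Complex.normSq (Y j i) := by
    have := trace_diagonal_conj p (fun _ : n => (1 : ℝ)) Y
    simp only [mul_one, Complex.ofReal_one, diagonal_one, Matrix.one_mul] at this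
    rw [← this]
    congr 1
    calc _ = (U * (diagonal (fun i => (p i : ℂ)) * (Uᴴ * U * (Yᴴ * (Vᴴ * V * Y * Uᴴ))))).trace := by
          simp only [conjTranspose_mul, conjTranspose_conjTranspose, Matrix.mul_assoc]
      _ = (diagonal (fun i => (p i : ℂ)) * Yᴴ * Y * (Uᴴ * U)).trace := by
          rw [trace_mul_comm]
          simp only [hU, hV, Matrix.one_mul, Matrix.mul_assoc]
      _ = _ := by
          rw [hU, Matrix.mul_one, Matrix.mul_assoc]
  rw [modularQuad, h1, h2, trace_mul_conj hU]
  simp only [Finset.mul_sum, ← Finset.sum_sub_distrib]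
  refine Finset.sum_congr rfl fun i _ => Finset.sum_congr rfl fun j _ => ?_
  ring

/-- Completing the square: |a z - b y|² ≥ 0. -/
lemma two_mul_re_sub_le {a b : ℝ} (hb : 0 < b) (z y : ℂ) :
    2 * (a * (star z * y).re) - b * Complex.normSq y ≤ a ^ 2 * Complex.normSq z / b := by
  rw [le_div_iff₀ hb]
  simp only [Complex.normSq_apply, Complex.mul_re, Complex.star_def, Complex.conj_re,
    Complex.conj_im]
  nlinarith [sq_nonneg (a * z.re - b * y.re), sq_nonneg (a * z.im - b * y.im)]

/-- The relative entropy is a limiting value of the primitive of the resolvent of the relative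
modular operator, the latter being the maximum of `modularQuad`. -/
theorem exists_modular_primitive {ρ σ : Matrix n n ℂ} (hρ : ρ.PosSemidef) (hσ : σ.PosSemidef)
    (hker : ∀ v : n → ℂ, σ *ᵥ v = 0 → ρ *ᵥ v = 0) :
    ∃ F F' : ℝ → ℝ, ContinuousOn F (Set.Ici 0) ∧ (∀ t, 0 < t → HasDerivAt F (F' t) t) ∧
      F 0 = -relEntropy ρ σ ∧
      Tendsto (fun t => F t - ρ.trace.re * Real.log t) atTop (𝓝 0) ∧
      ∀ t, 0 < t → IsGreatest (Set.range (modularQuad ρ σ t)) (F' t) := by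
  obtain ⟨U, p, hU, hU', hp, hρU, hlρ⟩ := exists_diagonalization hρ
  obtain ⟨V, q, hV, hV', hq, hσV, hlσ⟩ := exists_diagonalization hσ
  set W := Vᴴ * U with hW
  have hWW : Wᴴ * W = 1 := by
    rw [hW, conjTranspose_mul, conjTranspose_conjTranspose, Matrix.mul_assoc,
      ← Matrix.mul_assoc V, hV', Matrix.one_mul, hU]
  -- The kernel condition enters here: an eigenvector of σ for the eigenvalue 0 is killed by ρ, so
  -- the pair (i, j) has weight zero and log 0 never contributes.
  have hsupp : ∀ i j, q j = 0 → p i * Complex.normSq (W j i) = 0 := by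
    intro i j hj
    have h0 : σ *ᵥ (V *ᵥ Pi.single j 1) = 0 := by
      rw [hσV, mulVec_mulVec, Matrix.mul_assoc, hV, Matrix.mul_one, ← mulVec_mulVec]
      have : diagonal (fun i => (q i : ℂ)) *ᵥ Pi.single j 1 = 0 := by
        ext k
        by_cases hk : k = j
        · subst hk; simp [mulVec_diagonal, hj]
        · simp [mulVec_diagonal, hk]
      rw [this, mulVec_zero]
    have h1 := congrArg (Uᴴ *ᵥ ·) (hker _ h0)
    simp only [hρU, mulVec_mulVec, mulVec_zero] at h1
    rw [Matrix.mul_assoc, ← Matrix.mul_assoc Uᴴ, ← Matrix.mul_assoc Uᴴ, hU, Matrix.one_mul] at h1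
    have h2 := congrFun h1 i
    rw [← mulVec_mulVec, mulVec_diagonal] at h2
    have h3 : (Uᴴ * V) i j = star (W j i) := by
      rw [hW, ← conjTranspose_apply, conjTranspose_mul, conjTranspose_conjTranspose]
    rw [mulVec_single_one, col_apply, h3] at h2
    rcases mul_eq_zero.1 h2 with h | h
    · rw [Complex.ofReal_eq_zero.1 h, zero_mul]
    · rw [star_eq_zero.1 h, map_zero, mul_zero]
  have hpos : ∀ i j, p i * Complex.normSq (W j i) ≠ 0 → 0 < q j / p i := by
    intro i j h
    have h1 : q j ≠ 0 := fun h' => h (hsupp i j h')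
    have h2 : p i ≠ 0 := fun h' => h (by rw [h', zero_mul])
    exact div_pos (lt_of_le_of_ne (hq j) h1.symm) (lt_of_le_of_ne (hp i) h2.symm)
  have hnn : ∀ i j, 0 ≤ q j / p i := fun i j => div_nonneg (hq j) (hp i)
  -- Eigenvalues q_j/p_i with spectral weights p_i |W_ji|². The junk value q_j/0 = 0 is harmless
  -- because its weight vanishes.
  refine ⟨fun t => ∑ i, ∑ j, p i * Complex.normSq (W j i) * Real.log (q j / p i + t),
    fun t => ∑ i, ∑ j, p i * Complex.normSq (W j i) * (q j / p i + t)⁻¹, ?_, ?_, ?_, ?_, ?_⟩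
  · refine continuousOn_finsetSum _ fun i _ => continuousOn_finsetSum _ fun j _ => ?_
    by_cases h : p i * Complex.normSq (W j i) = 0
    · simp only [h, zero_mul]
      exact continuousOn_const
    · refine continuousOn_const.mul (ContinuousOn.log (by fun_prop) fun t ht => ?_)
      exact (add_pos_of_pos_of_nonneg (hpos i j h) ht).ne'
  · intro t ht
    refine HasDerivAt.fun_sum fun i _ => HasDerivAt.fun_sum fun j _ => ?_
    have : HasDerivAt (fun t => Real.log (q j / p i + t)) ((q j / p i + t)⁻¹) t := by
      simpa using ((hasDerivAt_id t).const_add (q j / p i)).log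
        (add_pos_of_nonneg_of_pos (hnn i j) ht).ne'
    exact this.const_mul _
  · have h1 : (ρ * logOp ρ).trace.re =
        ∑ i, ∑ j, p i * Complex.normSq (W j i) * Real.log (p i) := by
      rw [hlρ, hρU]
      have : U * diagonal (fun i => (p i : ℂ)) * Uᴴ *
          (U * diagonal (fun i => (Real.log (p i) : ℂ)) * Uᴴ) =
          U * diagonal (fun i => ((p i * Real.log (p i) : ℝ) : ℂ)) * Uᴴ := by
        calc _ = U * (diagonal (fun i => (p i : ℂ)) * (Uᴴ * U *
                diagonal (fun i => (Real.log (p i) : ℂ)))) * Uᴴ := by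
              simp only [Matrix.mul_assoc]
          _ = _ := by
              rw [hU, Matrix.one_mul, diagonal_mul_diagonal]
              simp only [Complex.ofReal_mul]
      rw [this, trace_diagonalized hU]
      refine Finset.sum_congr rfl fun i _ => ?_
      rw [← Finset.sum_mul, ← Finset.mul_sum, sum_normSq_col_eq_one hWW, mul_one]
    have h2 : (ρ * logOp σ).trace.re =
        ∑ i, ∑ j, p i * Complex.normSq (W j i) * Real.log (q j) := by
      rw [hlσ, hρU, trace_mul_diagonal_conj]
      refine Finset.sum_congr rfl fun i _ => Finset.sum_congr rfl fun j _ => ?_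
      ring
    rw [relEntropy, h1, h2, neg_sub]
    simp only [← Finset.sum_sub_distrib]
    refine Finset.sum_congr rfl fun i _ => Finset.sum_congr rfl fun j _ => ?_
    by_cases h : p i * Complex.normSq (W j i) = 0
    · simp only [h, zero_mul, sub_zero]
    · rw [add_zero, Real.log_div (fun h' => h (hsupp i j h'))
        (fun h' => h (by rw [h', zero_mul])), mul_sub]
  · have htr : ρ.trace.re = ∑ i, ∑ j, p i * Complex.normSq (W j i) := by
      conv_lhs => rw [hρU]
      rw [trace_diagonalized hU]
      refine Finset.sum_congr rfl fun i _ => ?_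
      rw [← Finset.mul_sum, sum_normSq_col_eq_one hWW, mul_one]
    simp only [htr, Finset.sum_mul, ← Finset.sum_sub_distrib, ← mul_sub]
    rw [show (0 : ℝ) = ∑ i : n, ∑ j : n, p i * Complex.normSq (W j i) * 0 by simp]
    refine tendsto_finsetSum _ fun i _ => tendsto_finsetSum _ fun j _ => ?_
    refine Tendsto.const_mul _ ?_
    have h1 : Tendsto (fun t : ℝ => Real.log (q j / p i / t + 1)) atTop (𝓝 0) := by
      have h0 : Tendsto (fun t : ℝ => q j / p i / t + 1) atTop (𝓝 1) := by
        simpa using (tendsto_const_nhds (x := q j / p i).div_atTop tendsto_id).add_const 1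
      simpa using h0.log one_ne_zero
    refine h1.congr' ?_
    filter_upwards [eventually_gt_atTop 0] with t ht
    rw [← Real.log_div (add_pos_of_nonneg_of_pos (hnn i j) ht).ne' ht.ne', add_div,
      div_self ht.ne']
  · intro t ht
    have hterm : ∀ i j, p i * Complex.normSq (W j i) * (q j / p i + t)⁻¹ =
        p i ^ 2 * Complex.normSq (W j i) / (q j + t * p i) := by
      intro i j
      rcases (hp i).eq_or_lt with h | h
      · simp [← h]
      · have : q j + t * p i ≠ 0 := (add_pos_of_nonneg_of_pos (hq j) (mul_pos ht h)).ne'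
        rw [show q j / p i + t = (q j + t * p i) / p i by field_simp, inv_div]
        field_simp
    simp only [hterm]
    constructor
    -- The stationary point of each scalar quadratic, p_i W_ji / (q_j + t p_i), transported back
    -- from the eigenbases.
    · refine ⟨V * (Matrix.of fun j i => ((p i / (q j + t * p i) : ℝ) : ℂ) * W j i) * Uᴴ, ?_⟩
      conv_lhs => rw [hρU, hσV]
      rw [modularQuad_diagonalized hU hV, ← hW]
      refine Finset.sum_congr rfl fun i _ => Finset.sum_congr rfl fun j _ => ?_
      rcases (hp i).eq_or_lt with h | h
      · simp [← h]
      · have : q j + t * p i ≠ 0 := (add_pos_of_nonneg_of_pos (hq j) (mul_pos ht h)).ne'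
        have e : (star (W j i) * (((p i / (q j + t * p i) : ℝ) : ℂ) * W j i)).re =
            p i / (q j + t * p i) * Complex.normSq (W j i) := by
          rw [mul_left_comm, Complex.re_ofReal_mul]
          simp [Complex.normSq_apply]
        rw [of_apply, e, Complex.normSq_mul, Complex.normSq_ofReal]
        field_simp
        ring
    · rintro _ ⟨X, rfl⟩
      have hX : X = V * (Vᴴ * X * U) * Uᴴ := by
        calc X = (V * Vᴴ) * X * (U * Uᴴ) := by rw [hU', hV', Matrix.one_mul, Matrix.mul_one]
          _ = _ := by simp only [Matrix.mul_assoc]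
      rw [hX]
      conv_lhs => rw [hρU, hσV]
      rw [modularQuad_diagonalized hU hV, ← hW]
      refine Finset.sum_le_sum fun i _ => Finset.sum_le_sum fun j _ => ?_
      have hb : 0 ≤ q j + t * p i := add_nonneg (hq j) (mul_nonneg ht.le (hp i))
      -- If q_j + t p_i = 0 then p_i = 0, as t > 0, and both sides of the entry's inequality are 0.
      rcases hb.eq_or_lt with h | h
      · have : p i = 0 := by nlinarith [hq j, hp i]
        rw [← h, this]
        simp
      · exact two_mul_re_sub_le h _ _

lemma le_zero_of_hasDerivAt_nonneg_of_tendsto {G G' : ℝ → ℝ} (hc : ContinuousOn G (Set.Ici 0))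
    (hd : ∀ t, 0 < t → HasDerivAt G (G' t) t) (hG' : ∀ t, 0 < t → 0 ≤ G' t)
    (hlim : Tendsto G atTop (𝓝 0)) : G 0 ≤ 0 := by
  have hmono : MonotoneOn G (Set.Ici 0) := by
    refine monotoneOn_of_deriv_nonneg (convex_Ici 0) hc ?_ ?_
    · rw [interior_Ici]
      exact fun t ht => (hd t ht).differentiableAt.differentiableWithinAt
    · rw [interior_Ici]
      exact fun t ht => (hd t ht).deriv ▸ hG' t ht
  refine ge_of_tendsto hlim ?_
  filter_upwards [eventually_ge_atTop 0] with t ht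
  exact hmono (Set.mem_Ici.2 le_rfl) ht ht

/-- The relative entropy of `ρ'` and `σ'` is at most that of `ρ` and `σ` if `ρ` and `ρ'` have the same
trace and `modularQuad ρ' σ'` is dominated by the values of `modularQuad ρ σ`. -/
theorem relEntropy_le_of_modularQuad {m : Type*} [Fintype m] [DecidableEq m]
    {ρ σ : Matrix n n ℂ} {ρ' σ' : Matrix m m ℂ} (hρ : ρ.PosSemidef) (hσ : σ.PosSemidef)
    (hker : ∀ v : n → ℂ, σ *ᵥ v = 0 → ρ *ᵥ v = 0) (hρ' : ρ'.PosSemidef) (hσ' : σ'.PosSemidef)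
    (hker' : ∀ v : m → ℂ, σ' *ᵥ v = 0 → ρ' *ᵥ v = 0) (htr : ρ'.trace = ρ.trace)
    (h : ∀ t X, ∃ Y, modularQuad ρ' σ' t X ≤ modularQuad ρ σ t Y) :
    relEntropy ρ' σ' ≤ relEntropy ρ σ := by
  obtain ⟨F, F', hc, hd, h0, hl, hg⟩ := exists_modular_primitive hρ hσ hker
  obtain ⟨E, E', hc', hd', h0', hl', hg'⟩ := exists_modular_primitive hρ' hσ' hker'
  have := le_zero_of_hasDerivAt_nonneg_of_tendsto (G := fun t => F t - E t)
    (G' := fun t => F' t - E' t) (hc.sub hc') (fun t ht => (hd t ht).sub (hd' t ht))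
    (fun t ht => ?_) ?_
  · simp only [h0, h0'] at this
    linarith
  · obtain ⟨X, hX⟩ := (hg' t ht).1
    obtain ⟨Y, hY⟩ := h t X
    have := (hg t ht).2 ⟨Y, rfl⟩
    linarith
  -- Equal traces make the two logarithmic divergences cancel.
  · have := hl.sub hl'
    rw [sub_zero] at this
    refine this.congr fun t => ?_
    rw [htr]
    ring

/-- **Klein's inequality**. -/
theorem relEntropy_nonneg {ρ σ : Matrix n n ℂ} (hρ : IsState ρ) (hσ : IsState σ)
    (hker : ∀ v : n → ℂ, σ *ᵥ v = 0 → ρ *ᵥ v = 0) : 0 ≤ relEntropy ρ σ := by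
  -- Klein's inequality is monotonicity under the full trace: the comparison system is
  -- one-dimensional, where the relative entropy is 0, and a scalar X is lifted to X · 1.
  have h := relEntropy_le_of_modularQuad (ρ' := (1 : Matrix Unit Unit ℂ))
    (σ' := (1 : Matrix Unit Unit ℂ)) hρ.1 hσ.1 hker PosSemidef.one PosSemidef.one (fun v hv => hv)
    (by rw [hρ.2]; simp) (fun t X => ⟨X () () • 1, ?_⟩)
  · simpa [relEntropy] using h
  · have e : ∀ M : Matrix Unit Unit ℂ, M.trace = M () () := fun M => by simp [Matrix.trace]
    simp only [modularQuad, e, Matrix.one_mul, Matrix.mul_apply]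
    simp [hρ.2, hσ.2, trace_smul]

end RelativeEntropy

end QInfo

set_option linter.unusedSectionVars false

namespace QInfo

open Matrix

/-! ### Support inclusion as reversed kernel inclusion -/

section Support

variable {n : Type*} [Fintype n] [DecidableEq n]

lemma supp_le_supp_iff {ρ σ : Matrix n n ℂ} :
    supp ρ ≤ supp σ ↔ ∀ v : n → ℂ, σ *ᵥ v = 0 → ρ *ᵥ v = 0 := by
  rw [supp, supp, Submodule.orthogonal_le_orthogonal_iff]
  constructor
  · intro h v hv
    have := @h (WithLp.toLp 2 v) (by simp [toLpLin_apply, hv])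
    simpa [toLpLin_apply] using this
  · intro h v hv
    have := h v.ofLp (by simpa [toLpLin_apply] using hv)
    simp [toLpLin_apply, this]

lemma ker_submatrix_le_iff {m : Type*} [Fintype m] (e : n ≃ m) {N : Matrix m m ℂ}
    {M : Matrix n n ℂ} :
    (∀ v : n → ℂ, N.submatrix e e *ᵥ v = 0 → M *ᵥ v = 0) ↔
      ∀ v : m → ℂ, N *ᵥ v = 0 → M.submatrix e.symm e.symm *ᵥ v = 0 := by
  simp only [submatrix_mulVec_equiv]
  constructor
  · intro h v hv
    have := h (v ∘ e) (by simp [Function.comp_assoc, hv])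
    rw [Equiv.symm_symm, this, Pi.zero_comp]
  · intro h v hv
    have h0 : N *ᵥ (v ∘ e.symm) = 0 := by
      have := congrArg (· ∘ e.symm) hv
      simpa [Function.comp_assoc] using this
    have := congrArg (· ∘ e) (h _ h0)
    simpa [Function.comp_assoc] using this

end Support

/-! ### Partial trace: kernels and monotonicity of relative entropy -/

section PartialTrace

variable {X Y : Type*} [Fintype X] [Fintype Y] [DecidableEq X] [DecidableEq Y]

lemma trace_traceFst (M : Matrix (X × Y) (X × Y) ℂ) : (traceFst M).trace = M.trace := by
  simp only [trace, diag_apply, traceFst, of_apply, Fintype.sum_prod_type]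
  exact Finset.sum_comm

lemma posSemidef_traceFst {M : Matrix (X × Y) (X × Y) ℂ} (hM : M.PosSemidef) :
    (traceFst M).PosSemidef := by
  have : traceFst M = ∑ x, M.submatrix (fun y => (x, y)) (fun y => (x, y)) := by
    ext i j
    simp [traceFst, Matrix.sum_apply]
  rw [this]
  exact posSemidef_sum _ fun x _ => hM.submatrix _

lemma IsState.traceFst {M : Matrix (X × Y) (X × Y) ℂ} (hM : IsState M) :
    IsState (traceFst M) :=
  ⟨posSemidef_traceFst hM.1, by rw [trace_traceFst, hM.2]⟩

lemma trace_mul_one_kronecker (M : Matrix (X × Y) (X × Y) ℂ) (N : Matrix Y Y ℂ) :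
    (M * ((1 : Matrix X X ℂ) ⊗ₖ N)).trace = (traceFst M * N).trace := by
  have h : ∀ x y, (M * ((1 : Matrix X X ℂ) ⊗ₖ N)) (x, y) (x, y) =
      ∑ z, M (x, y) (x, z) * N z y := by
    intro x y
    rw [Matrix.mul_apply, Fintype.sum_prod_type, Finset.sum_eq_single x]
    · simp
    · intro x' _ hx'
      simp [one_apply_ne hx']
    · simp
  simp only [trace, diag_apply, Fintype.sum_prod_type, h]
  simp only [Matrix.mul_apply, traceFst, of_apply, Finset.sum_mul]
  rw [Finset.sum_comm]
  exact Finset.sum_congr rfl fun _ _ => Finset.sum_comm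

/-- N ↦ 1 ⊗ N is a *-homomorphism adjoint to the partial trace, so it carries each of the three
terms to its counterpart. -/
lemma modularQuad_traceFst (ρ σ : Matrix (X × Y) (X × Y) ℂ) (t : ℝ) (N : Matrix Y Y ℂ) :
    modularQuad (traceFst ρ) (traceFst σ) t N =
      modularQuad ρ σ t ((1 : Matrix X X ℂ) ⊗ₖ N) := by
  simp only [modularQuad, conjTranspose_kronecker, conjTranspose_one, ← mul_kronecker_mul,
    Matrix.one_mul, trace_mul_one_kronecker]

/-- The vector `e_x ⊗ v`. -/
def singleTensor (x : X) (v : Y → ℂ) : X × Y → ℂ := fun p => if p.1 = x then v p.2 else 0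

lemma sum_singleTensor (w : X × Y → ℂ) : ∑ x, singleTensor x (fun y => w (x, y)) = w := by
  ext ⟨x, y⟩
  simp [singleTensor, Finset.sum_apply]

lemma submatrix_mulVec_eq (M : Matrix (X × Y) (X × Y) ℂ) (x : X) (v : Y → ℂ) (z : X) (y : Y) :
    (M *ᵥ singleTensor x v) (z, y) =
      (M.submatrix (fun y => (z, y)) (fun y => (x, y)) *ᵥ v) y := by
  simp [mulVec, dotProduct, singleTensor, Fintype.sum_prod_type]

lemma traceFst_mulVec (M : Matrix (X × Y) (X × Y) ℂ) (v : Y → ℂ) (y : Y) :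
    (traceFst M *ᵥ v) y = ∑ x, (M *ᵥ singleTensor x v) (x, y) := by
  simp only [submatrix_mulVec_eq]
  simp only [mulVec, dotProduct, traceFst, of_apply, submatrix_apply, Finset.sum_mul]
  exact Finset.sum_comm

lemma star_singleTensor_dotProduct (x : X) (v : Y → ℂ) (w : X × Y → ℂ) :
    star (singleTensor x v) ⬝ᵥ w = ∑ y, star (v y) * w (x, y) := by
  simp [dotProduct, singleTensor, Fintype.sum_prod_type, apply_ite]

/-- ⟨v, (tr_X M) v⟩ is the sum over x of ⟨e_x ⊗ v, M (e_x ⊗ v)⟩. For positive semidefinite M these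
terms are nonnegative, and each vanishes only if M kills e_x ⊗ v. -/
lemma traceFst_mulVec_eq_zero_iff {M : Matrix (X × Y) (X × Y) ℂ} (hM : M.PosSemidef)
    (v : Y → ℂ) : traceFst M *ᵥ v = 0 ↔ ∀ x, M *ᵥ singleTensor x v = 0 := by
  constructor
  · intro h x
    have h1 : ∑ x, star (singleTensor x v) ⬝ᵥ M *ᵥ singleTensor x v = 0 := by
      have h2 : star v ⬝ᵥ traceFst M *ᵥ v = 0 := by rw [h, dotProduct_zero]
      rw [← h2]
      simp only [star_singleTensor_dotProduct]
      simp only [dotProduct, traceFst_mulVec, Finset.mul_sum, Pi.star_apply]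
      exact Finset.sum_comm
    rw [Finset.sum_eq_zero_iff_of_nonneg fun x _ => hM.dotProduct_mulVec_nonneg _] at h1
    exact (hM.dotProduct_mulVec_zero_iff _).1 (h1 x (Finset.mem_univ x))
  · intro h
    ext y
    simp [traceFst_mulVec, h]

lemma one_kronecker_mulVec (N : Matrix Y Y ℂ) (w : X × Y → ℂ) (x : X) (y : Y) :
    (((1 : Matrix X X ℂ) ⊗ₖ N) *ᵥ w) (x, y) = (N *ᵥ fun y => w (x, y)) y := by
  simp [mulVec, dotProduct, Fintype.sum_prod_type, one_apply, ite_mul]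

lemma ker_traceFst_mono {ρ σ : Matrix (X × Y) (X × Y) ℂ} (hρ : ρ.PosSemidef)
    (hσ : σ.PosSemidef) (h : ∀ v : X × Y → ℂ, σ *ᵥ v = 0 → ρ *ᵥ v = 0) (v : Y → ℂ)
    (hv : traceFst σ *ᵥ v = 0) : traceFst ρ *ᵥ v = 0 := by
  rw [traceFst_mulVec_eq_zero_iff hσ] at hv
  rw [traceFst_mulVec_eq_zero_iff hρ]
  exact fun x => h _ (hv x)

/-- The kernel of 1 ⊗ N is spanned by the vectors e_x ⊗ v with v in the kernel of N. -/
lemma ker_one_kronecker_le_iff {ρ : Matrix (X × Y) (X × Y) ℂ} (hρ : ρ.PosSemidef)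
    {N : Matrix Y Y ℂ} :
    (∀ v : X × Y → ℂ, ((1 : Matrix X X ℂ) ⊗ₖ N) *ᵥ v = 0 → ρ *ᵥ v = 0) ↔
      ∀ v : Y → ℂ, N *ᵥ v = 0 → traceFst ρ *ᵥ v = 0 := by
  constructor
  · intro h v hv
    rw [traceFst_mulVec_eq_zero_iff hρ]
    refine fun x => h _ ?_
    ext ⟨z, y⟩
    rw [one_kronecker_mulVec]
    by_cases hz : z = x
    · simpa [singleTensor, hz] using congrFun hv y
    · simp [singleTensor, hz, mulVec, dotProduct]
  · intro h w hw
    have h1 : ∀ x, ρ *ᵥ singleTensor x (fun y => w (x, y)) = 0 := by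
      intro x
      refine (traceFst_mulVec_eq_zero_iff hρ _).1 (h _ ?_) x
      ext y
      rw [← one_kronecker_mulVec, hw]
      rfl
    rw [← sum_singleTensor w, mulVec_sum]
    exact Finset.sum_eq_zero fun x _ => h1 x

/-- Monotonicity of the relative entropy under partial trace. -/
theorem relEntropy_traceFst_le {ρ σ : Matrix (X × Y) (X × Y) ℂ} (hρ : ρ.PosSemidef)
    (hσ : σ.PosSemidef) (h : ∀ v : X × Y → ℂ, σ *ᵥ v = 0 → ρ *ᵥ v = 0) :
    relEntropy (traceFst ρ) (traceFst σ) ≤ relEntropy ρ σ :=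
  relEntropy_le_of_modularQuad hρ hσ h (posSemidef_traceFst hρ) (posSemidef_traceFst hσ)
    (ker_traceFst_mono hρ hσ h) (trace_traceFst ρ)
    fun t N => ⟨1 ⊗ₖ N, (modularQuad_traceFst ρ σ t N).le⟩

end PartialTrace

/-! ### Marginals of a tripartite state and the decomposition of Δ -/

section Tripartite

variable {A B C : Type*} [Fintype A] [Fintype B] [Fintype C]
  [DecidableEq A] [DecidableEq B] [DecidableEq C] {ρ σ : Matrix (A × B × C) (A × B × C) ℂ}

/-- The exchange of the first two of three tensor factors. -/
def swapAB (A B C : Type*) : A × B × C ≃ B × A × C where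
  toFun i := (i.2.1, i.1, i.2.2)
  invFun i := (i.2.1, i.1, i.2.2)

lemma margAC_eq (M : Matrix (A × B × C) (A × B × C) ℂ) :
    margAC M = traceFst (M.submatrix (swapAB A B C).symm (swapAB A B C).symm) := rfl

lemma extAC_eq (M : Matrix (A × C) (A × C) ℂ) :
    extAC (B := B) M = ((1 : Matrix B B ℂ) ⊗ₖ M).submatrix (swapAB A B C) (swapAB A B C) := by
  ext i j
  -- The identity on B is the right Kronecker factor on one side and the left factor on the other.
  exact mul_comm _ _

lemma IsState.submatrix {n m : Type*} [Fintype n] [Fintype m] {M : Matrix n n ℂ}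
    (hM : IsState M) (e : m ≃ n) : IsState (M.submatrix e e) := by
  refine ⟨hM.1.submatrix e, ?_⟩
  rw [← hM.2]
  exact e.sum_comp fun i => M i i

lemma IsState.margAC (hρ : IsState ρ) : IsState (margAC ρ) :=
  (hρ.submatrix (swapAB A B C).symm).traceFst

lemma IsState.margBC (hρ : IsState ρ) : IsState (margBC ρ) := hρ.traceFst

lemma IsState.margC (hρ : IsState ρ) : IsState (margC ρ) := hρ.traceFst.traceFst

lemma traceFst_margAC (M : Matrix (A × B × C) (A × B × C) ℂ) :
    traceFst (margAC M) = margC M := by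
  ext i j
  exact Finset.sum_comm

/-- Moves the support condition from ABC down to the marginal, in the form Klein's inequality and
monotonicity require. -/
lemma mem_statesAC_iff (hρ : IsState ρ) {τ : Matrix (A × C) (A × C) ℂ} :
    τ ∈ statesAC ρ ↔ IsState τ ∧ ∀ v : A × C → ℂ, τ *ᵥ v = 0 → margAC ρ *ᵥ v = 0 := by
  refine and_congr_right fun _ => ?_
  rw [supp_le_supp_iff, extAC_eq, ker_submatrix_le_iff,
    ker_one_kronecker_le_iff (hρ.1.submatrix _), margAC_eq]

lemma mem_statesBC_iff (hρ : IsState ρ) {θ : Matrix (B × C) (B × C) ℂ} :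
    θ ∈ statesBC ρ ↔ IsState θ ∧ ∀ v : B × C → ℂ, θ *ᵥ v = 0 → margBC ρ *ᵥ v = 0 := by
  refine and_congr_right fun _ => ?_
  rw [supp_le_supp_iff, extBC, ker_one_kronecker_le_iff hρ.1, margBC]

lemma mem_statesC_iff (hρ : IsState ρ) {ω : Matrix C C ℂ} :
    ω ∈ statesC ρ ↔ IsState ω ∧ ∀ v : C → ℂ, ω *ᵥ v = 0 → margC ρ *ᵥ v = 0 := by
  refine and_congr_right fun _ => ?_
  rw [supp_le_supp_iff, extC, ker_one_kronecker_le_iff hρ.1,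
    ker_one_kronecker_le_iff hρ.traceFst.1, margC]

lemma margAC_mem_statesAC (hρ : IsState ρ) (hσ : σ ∈ statesABC ρ) :
    margAC σ ∈ statesAC ρ := by
  refine (mem_statesAC_iff hρ).2 ⟨hσ.1.margAC, ?_⟩
  have h := supp_le_supp_iff.1 hσ.2
  rw [← submatrix_id_id σ, ← Equiv.symm_comp_self (swapAB A B C), ← submatrix_submatrix,
    ker_submatrix_le_iff] at h
  rw [margAC_eq, margAC_eq]
  exact ker_traceFst_mono (hρ.1.submatrix _) (hσ.1.1.submatrix _) h

lemma margBC_mem_statesBC (hρ : IsState ρ) (hσ : σ ∈ statesABC ρ) :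
    margBC σ ∈ statesBC ρ :=
  (mem_statesBC_iff hρ).2
    ⟨hσ.1.margBC, ker_traceFst_mono hρ.1 hσ.1.1 (supp_le_supp_iff.1 hσ.2)⟩

lemma relEntropy_margC_le_margAC (hρ : IsState ρ) {τ : Matrix (A × C) (A × C) ℂ}
    (hτ : τ ∈ statesAC ρ) :
    relEntropy (margC ρ) (traceFst τ) ≤ relEntropy (margAC ρ) τ := by
  rw [← traceFst_margAC]
  obtain ⟨h, hk⟩ := (mem_statesAC_iff hρ).1 hτ
  exact relEntropy_traceFst_le hρ.margAC.1 h.1 hk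

lemma relEntropy_margC_le_margBC (hρ : IsState ρ) {θ : Matrix (B × C) (B × C) ℂ}
    (hθ : θ ∈ statesBC ρ) :
    relEntropy (margC ρ) (traceFst θ) ≤ relEntropy (margBC ρ) θ := by
  obtain ⟨h, hk⟩ := (mem_statesBC_iff hρ).1 hθ
  exact relEntropy_traceFst_le hρ.margBC.1 h.1 hk

lemma trace_mul_extAC (M : Matrix (A × B × C) (A × B × C) ℂ) (N : Matrix (A × C) (A × C) ℂ) :
    (M * extAC N).trace = (margAC M * N).trace := by
  rw [margAC_eq, ← trace_mul_one_kronecker, extAC_eq]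
  conv_lhs => rw [← submatrix_id_id M, ← Equiv.symm_comp_self (swapAB A B C),
    ← submatrix_submatrix, submatrix_mul_equiv]
  exact (swapAB A B C).sum_comp fun i =>
    (M.submatrix (swapAB A B C).symm (swapAB A B C).symm * ((1 : Matrix B B ℂ) ⊗ₖ N)) i i

/-- `Δ` differs from the conditional mutual information by the relative entropies of the
marginals of `ρ`. -/
theorem Delta_eq (ρ : Matrix (A × B × C) (A × B × C) ℂ) (τ : Matrix (A × C) (A × C) ℂ)
    (θ : Matrix (B × C) (B × C) ℂ) (ω : Matrix C C ℂ) :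
    Delta ρ τ θ ω = condMutualInfo ρ + relEntropy (margAC ρ) τ + relEntropy (margBC ρ) θ -
      relEntropy (margC ρ) ω := by
  simp only [Delta, Matrix.mul_add, Matrix.mul_sub, trace_add, trace_sub, Complex.add_re,
    Complex.sub_re, trace_mul_extAC, extBC, extC, trace_mul_one_kronecker, condMutualInfo,
    relEntropy, entropy, margBC, margC]
  ring

end Tripartite

/-! ### Attained extrema and saddle points -/

section Optimization

variable {X Y : Type*} {S : Set X} {T : Set Y} {x₀ : X} {y₀ : Y} {v : EReal}

lemma InfAttained.of_le {f : X → EReal} (hx : x₀ ∈ S) (h : ∀ x ∈ S, f x₀ ≤ f x)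
    (hv : f x₀ = v) : InfAttained S f x₀ v :=
  ⟨(le_antisymm (iInf₂_le x₀ hx) (le_iInf₂ h)).trans hv, hx, hv⟩

lemma SupAttained.of_le {f : X → EReal} (hx : x₀ ∈ S) (h : ∀ x ∈ S, f x ≤ f x₀)
    (hv : f x₀ = v) : SupAttained S f x₀ v :=
  ⟨(le_antisymm (iSup₂_le h) (le_iSup₂ (f := fun x _ => f x) x₀ hx)).trans hv, hx, hv⟩

/-- Infimum and supremum interchange for functions whose minimizer and maximizer do not depend on
the other variable. -/
lemma InfSupAttained.of_le {f : X → Y → EReal} (hx : x₀ ∈ S) (hy : y₀ ∈ T)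
    (h₁ : ∀ x ∈ S, ∀ y ∈ T, f x₀ y ≤ f x y) (h₂ : ∀ x ∈ S, ∀ y ∈ T, f x y ≤ f x y₀)
    (hv : f x₀ y₀ = v) : InfSupAttained S T f x₀ y₀ v := by
  have hS : ∀ x ∈ S, ⨆ y ∈ T, f x y = f x y₀ := fun x hx' =>
    (SupAttained.of_le hy (h₂ x hx') rfl).1
  have hI : ∀ y ∈ T, ⨅ x ∈ S, f x y = f x₀ y := fun y hy' =>
    (InfAttained.of_le hx (fun x hx' => h₁ x hx' y hy') rfl).1
  refine ⟨.of_le hx ?_ ((hS x₀ hx).trans hv), .of_le hy ?_ ((hI y₀ hy).trans hv),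
    fun x hx' => .of_le hy (h₂ x hx') (hS x hx').symm,
    fun y hy' => .of_le hx (fun x hx' => h₁ x hx' y hy') (hI y hy').symm⟩
  · intro x hx'
    rw [hS x hx', hS x₀ hx]
    exact h₁ x hx' y₀ hy
  · intro y hy'
    rw [hI y hy', hI y₀ hy]
    exact h₂ x₀ hx y hy'

end Optimization

end QInfo

/-! ### The variational formulas -/

theorem mainTheorem11 {A B C : Type*} [Fintype A] [Fintype B] [Fintype C]
    [DecidableEq A] [DecidableEq B] [DecidableEq C]
    (ρ : Matrix (A × B × C) (A × B × C) ℂ) (hρ : QInfo.IsState ρ) :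
    let I : EReal := (QInfo.condMutualInfo ρ : ℝ)
    let Δ : Matrix (A × C) (A × C) ℂ → Matrix (B × C) (B × C) ℂ → Matrix C C ℂ → EReal :=
      fun τ θ ω => (QInfo.Delta ρ τ θ ω : ℝ)
    let ρAC := QInfo.margAC ρ
    let ρBC := QInfo.margBC ρ
    let ρC := QInfo.margC ρ
    let SAC := QInfo.statesAC ρ
    let SBC := QInfo.statesBC ρ
    let SC := QInfo.statesC ρ
    let SABC := QInfo.statesABC ρ
    I = Δ ρAC ρBC ρC ∧
    QInfo.InfAttained SAC (fun τ => Δ τ ρBC ρC) ρAC I ∧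
    QInfo.InfAttained SBC (fun θ => Δ ρAC θ ρC) ρBC I ∧
    QInfo.SupAttained SC (fun ω => Δ ρAC ρBC ω) ρC I ∧
    QInfo.InfAttained SAC (fun τ => Δ τ ρBC (QInfo.traceFst τ)) ρAC I ∧
    QInfo.InfSupAttained SAC SC (fun τ ω => Δ τ ρBC ω) ρAC ρC I ∧
    QInfo.InfAttained SBC (fun θ => Δ ρAC θ (QInfo.traceFst θ)) ρBC I ∧
    QInfo.InfSupAttained SBC SC (fun θ ω => Δ ρAC θ ω) ρBC ρC I ∧
    QInfo.InfAttained SABC (fun σ => Δ (QInfo.margAC σ) (QInfo.margBC σ) ρC) ρ I ∧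
    QInfo.InfAttained (SAC ×ˢ SBC) (fun p => Δ p.1 p.2 ρC) (ρAC, ρBC) I ∧
    QInfo.InfAttained SABC
      (fun σ => Δ (QInfo.margAC σ) (QInfo.margBC σ) (QInfo.margC σ)) ρ I ∧
    QInfo.InfAttained (SAC ×ˢ SBC) (fun p => Δ p.1 p.2 (QInfo.traceFst p.1)) (ρAC, ρBC) I ∧
    QInfo.InfAttained (SAC ×ˢ SBC) (fun p => Δ p.1 p.2 (QInfo.traceFst p.2)) (ρAC, ρBC) I ∧
    QInfo.InfSupAttained SABC SC
      (fun σ ω => Δ (QInfo.margAC σ) (QInfo.margBC σ) ω) ρ ρC I ∧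
    QInfo.InfSupAttained (SAC ×ˢ SBC) SC (fun p ω => Δ p.1 p.2 ω) (ρAC, ρBC) ρC I ∧
    -- the two orders in which the supremum stands between the infima
    QInfo.InfAttained SAC (fun τ => ⨆ ω ∈ SC, ⨅ θ ∈ SBC, Δ τ θ ω) ρAC I ∧
    (∀ τ ∈ SAC, QInfo.InfSupAttained SBC SC (fun θ ω => Δ τ θ ω) ρBC ρC
      (⨆ ω ∈ SC, ⨅ θ ∈ SBC, Δ τ θ ω)) ∧
    QInfo.InfAttained SBC (fun θ => ⨆ ω ∈ SC, ⨅ τ ∈ SAC, Δ τ θ ω) ρBC I ∧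
    (∀ θ ∈ SBC, QInfo.InfSupAttained SAC SC (fun τ ω => Δ τ θ ω) ρAC ρC
      (⨆ ω ∈ SC, ⨅ τ ∈ SAC, Δ τ θ ω)) := by

  intro I Δ ρAC ρBC ρC SAC SBC SC SABC
  have hΔ : ∀ τ θ ω, Δ τ θ ω = ((QInfo.condMutualInfo ρ + QInfo.relEntropy ρAC τ +
      QInfo.relEntropy ρBC θ - QInfo.relEntropy ρC ω : ℝ) : EReal) := fun τ θ ω =>
    congrArg Real.toEReal (QInfo.Delta_eq ρ τ θ ω)
  have hρABC : ρ ∈ SABC := ⟨hρ, le_rfl⟩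
  have hAC : ρAC ∈ SAC := QInfo.margAC_mem_statesAC hρ hρABC
  have hBC : ρBC ∈ SBC := QInfo.margBC_mem_statesBC hρ hρABC
  have hC : ρC ∈ SC := (QInfo.mem_statesC_iff hρ).2 ⟨hρ.margC, fun _ h => h⟩
  have hP : (ρAC, ρBC) ∈ SAC ×ˢ SBC := ⟨hAC, hBC⟩
  have hmAC : ∀ σ ∈ SABC, QInfo.margAC σ ∈ SAC := fun σ => QInfo.margAC_mem_statesAC hρ
  have hmBC : ∀ σ ∈ SABC, QInfo.margBC σ ∈ SBC := fun σ => QInfo.margBC_mem_statesBC hρ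
  have hτ : ∀ τ ∈ SAC, 0 ≤ QInfo.relEntropy ρAC τ := fun τ h =>
    have h' := (QInfo.mem_statesAC_iff hρ).1 h
    QInfo.relEntropy_nonneg hρ.margAC h'.1 h'.2
  have hθ : ∀ θ ∈ SBC, 0 ≤ QInfo.relEntropy ρBC θ := fun θ h =>
    have h' := (QInfo.mem_statesBC_iff hρ).1 h
    QInfo.relEntropy_nonneg hρ.margBC h'.1 h'.2
  have hω : ∀ ω ∈ SC, 0 ≤ QInfo.relEntropy ρC ω := fun ω h =>
    have h' := (QInfo.mem_statesC_iff hρ).1 h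
    QInfo.relEntropy_nonneg hρ.margC h'.1 h'.2
  have hτC : ∀ τ ∈ SAC, QInfo.relEntropy ρC (QInfo.traceFst τ) ≤ QInfo.relEntropy ρAC τ :=
    fun τ => QInfo.relEntropy_margC_le_margAC hρ
  have hθC : ∀ θ ∈ SBC, QInfo.relEntropy ρC (QInfo.traceFst θ) ≤ QInfo.relEntropy ρBC θ :=
    fun θ => QInfo.relEntropy_margC_le_margBC hρ
  have hτ₀ : QInfo.relEntropy ρAC ρAC = 0 := sub_self _
  have hθ₀ : QInfo.relEntropy ρBC ρBC = 0 := sub_self _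
  have hω₀ : QInfo.relEntropy ρC ρC = 0 := sub_self _
  have hI : Δ ρAC ρBC ρC = I := by
    rw [hΔ, hτ₀, hθ₀, hω₀, add_zero, add_zero, sub_zero]
  have hACC : QInfo.traceFst ρAC = ρC := QInfo.traceFst_margAC ρ
  have hmono : ∀ {τ θ ω τ' θ' ω'}, QInfo.relEntropy ρAC τ + QInfo.relEntropy ρBC θ -
      QInfo.relEntropy ρC ω ≤ QInfo.relEntropy ρAC τ' + QInfo.relEntropy ρBC θ' -
      QInfo.relEntropy ρC ω' → Δ τ θ ω ≤ Δ τ' θ' ω' := by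
    intro τ θ ω τ' θ' ω' h
    rw [hΔ, hΔ, EReal.coe_le_coe_iff]
    linarith
  have hminP : ∀ {p ω}, p ∈ SAC ×ˢ SBC → Δ ρAC ρBC ω ≤ Δ p.1 p.2 ω := fun {p ω} hp =>
    hmono (by linarith [hτ _ hp.1, hθ _ hp.2])
  have hminτ : ∀ {τ θ ω}, τ ∈ SAC → Δ ρAC θ ω ≤ Δ τ θ ω := fun {τ θ ω} h =>
    hmono (by linarith [hτ _ h])
  have hminθ : ∀ {τ θ ω}, θ ∈ SBC → Δ τ ρBC ω ≤ Δ τ θ ω := fun {τ θ ω} h =>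
    hmono (by linarith [hθ _ h])
  have hmax : ∀ {τ θ ω}, ω ∈ SC → Δ τ θ ω ≤ Δ τ θ ρC := fun {τ θ ω} h =>
    hmono (by linarith [hω _ h])
  -- The subtracted D(ρ_C‖τ_C) is absorbed by D(ρ_AC‖τ) through monotonicity; Klein handles θ.
  have hminτC : ∀ {τ θ}, τ ∈ SAC → θ ∈ SBC → Δ ρAC ρBC ρC ≤ Δ τ θ (QInfo.traceFst τ) :=
    fun {τ θ} h h' => hmono (by linarith [hτC _ h, hθ _ h'])
  have hminθC : ∀ {τ θ}, τ ∈ SAC → θ ∈ SBC → Δ ρAC ρBC ρC ≤ Δ τ θ (QInfo.traceFst θ) :=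
    fun {τ θ} h h' => hmono (by linarith [hθC _ h', hτ _ h])
  -- With τ fixed, (ρ_BC, ρ_C) is a saddle point whatever τ is. This reduces the orders with the
  -- supremum between the infima to a minimization over τ alone.
  have hsaddleBC : ∀ τ, QInfo.InfSupAttained SBC SC (fun θ ω => Δ τ θ ω) ρBC ρC
      (Δ τ ρBC ρC) := fun τ =>
    .of_le hBC hC (fun _ h _ _ => hminθ h) (fun _ _ _ h => hmax h) rfl
  have hsaddleAC : ∀ θ, QInfo.InfSupAttained SAC SC (fun τ ω => Δ τ θ ω) ρAC ρC
      (Δ ρAC θ ρC) := fun θ =>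
    .of_le hAC hC (fun _ h _ _ => hminτ h) (fun _ _ _ h => hmax h) rfl
  have hsupBC : ∀ τ, ⨆ ω ∈ SC, ⨅ θ ∈ SBC, Δ τ θ ω = Δ τ ρBC ρC := fun τ => (hsaddleBC τ).2.1.1
  have hsupAC : ∀ θ, ⨆ ω ∈ SC, ⨅ τ ∈ SAC, Δ τ θ ω = Δ ρAC θ ρC := fun θ => (hsaddleAC θ).2.1.1
  refine ⟨hI.symm, .of_le hAC (fun _ h => hminτ h) hI, .of_le hBC (fun _ h => hminθ h) hI,
    .of_le hC (fun _ h => hmax h) hI, .of_le hAC (fun _ h => ?_) (hACC ▸ hI),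
    hI ▸ hsaddleAC ρBC, .of_le hBC (fun _ h => hminθC hAC h) hI, hI ▸ hsaddleBC ρAC,
    .of_le hρABC (fun σ h => hminP (p := (_, _)) ⟨hmAC σ h, hmBC σ h⟩) hI,
    .of_le hP (fun _ h => hminP h) hI,
    .of_le hρABC (fun σ h => hminθC (hmAC σ h) (hmBC σ h)) hI,
    .of_le hP (fun p h => ?_) (hACC ▸ hI), .of_le hP (fun p h => hminθC h.1 h.2) hI,
    .of_le hρABC hC (fun σ h _ _ => hminP (p := (_, _)) ⟨hmAC σ h, hmBC σ h⟩)
      (fun _ _ _ h => hmax h) hI,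
    .of_le hP hC (fun _ h _ _ => hminP h) (fun _ _ _ h => hmax h) hI,
    .of_le hAC (fun τ h => ?_) ((hsupBC ρAC).trans hI), fun τ _ => ?_,
    .of_le hBC (fun θ h => ?_) ((hsupAC ρBC).trans hI), fun θ _ => ?_⟩
  · rw [hACC]
    exact hminτC h hBC
  · rw [hACC]
    exact hminτC h.1 h.2
  · rw [hsupBC, hsupBC]
    exact hminτ h
  · rw [hsupBC]
    exact hsaddleBC τ
  · rw [hsupAC, hsupAC]
    exact hminθ h
  · rw [hsupAC]
    exact hsaddleAC θ
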